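/- Let $N\in\mathbb N$ and let $\rho$ be a state (a positive semidefinite operator of trace one) on $\mathbb C^2\otimes\mathbb C^2\otimes\mathbb C^N$ (Alice, Bob, Charlie) such that: (i) $\rho$ is supported on $\mathbb C^2\otimes\mathbb C^2\otimes\mathbb C^N$, i.e. its reduced states on the three tensor factors have full ranks $2$, $2$ and $N$; (ii) the partial transposes of $\rho$ with respect to each of the subsystems are positive semidefinite; (iii) $\rho$ has rank $N$. Then $\rho$ is fully separable, i.e. it is a convex combination of projectors onto unit product vectors $e\otimes f\otimes g$. Moreover, $\rho$ can be brought to the following canonical form by a reversible local operation, namely a change of the orthonormal bases of Alice and Bob: there are unitary operators $U,V$ on $\mathbb C^2$ and operators $B,C,D$ on Charlie's space $\mathbb C^N$ such that $D$ is positive definite (in particular $D=D^\dagger$), $[B,B^\dagger]=[C,C^\dagger]=[C,B]=[C,B^\dagger]=0$, and, in block form with respect to the basis $|00\rangle,|01\rangle,|10\rangle,|11\rangle$ of Alice's and Bob's space, $$(U\otimes V\otimes 1)\,\rho\,(U\otimes V\otimes 1)^\dagger=\sqrt D\begin{pmatrix}B^\dagger C^\dagger\\ C^\dagger\\ B^\dagger\\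 1\end{pmatrix}\begin{pmatrix}CB& C& B& 1\end{pmatrix}\sqrt D,$$ where $\sqrt D$ stands for $1\otimes 1\otimes\sqrt D$. -/

import Mathlib

open scoped Matrix Kronecker MatrixOrder ComplexOrder

noncomputable section

namespace Tripartite

/-- Operators on `ℂ² ⊗ ℂ² ⊗ ℂᴺ` (Alice, Bob, Charlie), written as matrices in the standard
product basis, which is indexed by `Fin 2 × Fin 2 × Fin N`. -/
abbrev Op (N : ℕ) : Type := Matrix (Fin 2 × Fin 2 × Fin N) (Fin 2 × Fin 2 × Fin N) ℂ

/-- A (mixed) quantum state: a positive semidefinite matrix of trace one. -/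
def IsState {N : ℕ} (ρ : Op N) : Prop := ρ.PosSemidef ∧ ρ.trace = 1

/-- Partial transpose with respect to Alice. -/
def partialTransposeA {N : ℕ} (ρ : Op N) : Op N :=
  Matrix.of fun x y => ρ (y.1, x.2.1, x.2.2) (x.1, y.2.1, y.2.2)

/-- Partial transpose with respect to Bob. -/
def partialTransposeB {N : ℕ} (ρ : Op N) : Op N :=
  Matrix.of fun x y => ρ (x.1, y.2.1, x.2.2) (y.1, x.2.1, y.2.2)

/-- Partial transpose with respect to Charlie. -/
def partialTransposeC {N : ℕ} (ρ : Op N) : Op N :=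
  Matrix.of fun x y => ρ (x.1, x.2.1, y.2.2) (y.1, y.2.1, x.2.2)

/-- `ρ` has positive partial transposes with respect to all subsystems. The partial transposes
with respect to `AB`, `AC`, `BC` are the full transposes of those with respect to `C`, `B`, `A`,
so that their positivity is the same condition. -/
def IsPPT {N : ℕ} (ρ : Op N) : Prop :=
  (partialTransposeA ρ).PosSemidef ∧ (partialTransposeB ρ).PosSemidef ∧
    (partialTransposeC ρ).PosSemidef

/-- Reduced operator of Alice (partial trace over Bob and Charlie). -/
def reducedA {N : ℕ} (ρ : Op N) : Matrix (Fin 2) (Fin 2) ℂ :=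
  Matrix.of fun i i' => ∑ j, ∑ n, ρ (i, j, n) (i', j, n)

/-- Reduced operator of Bob (partial trace over Alice and Charlie). -/
def reducedB {N : ℕ} (ρ : Op N) : Matrix (Fin 2) (Fin 2) ℂ :=
  Matrix.of fun j j' => ∑ i, ∑ n, ρ (i, j, n) (i, j', n)

/-- Reduced operator of Charlie (partial trace over Alice and Bob). -/
def reducedC {N : ℕ} (ρ : Op N) : Matrix (Fin N) (Fin N) ℂ :=
  Matrix.of fun n n' => ∑ i, ∑ j, ρ (i, j, n) (i, j, n')

/-- `ρ` is supported on `ℂ² ⊗ ℂ² ⊗ ℂᴺ`: all its reduced operators have full rank, that is, its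
range lies in no `V_A ⊗ V_B ⊗ V_C` with one of the local subspaces proper. -/
def IsSupported {N : ℕ} (ρ : Op N) : Prop :=
  (reducedA ρ).rank = 2 ∧ (reducedB ρ).rank = 2 ∧ (reducedC ρ).rank = N

/-- The product vector `e ⊗ f ⊗ g`. -/
def productVector {N : ℕ} (e f : Fin 2 → ℂ) (g : Fin N → ℂ) : Fin 2 × Fin 2 × Fin N → ℂ :=
  fun x => e x.1 * f x.2.1 * g x.2.2

/-- Full separability: `ρ` is a convex combination of projectors onto unit product vectors. -/
def IsSeparable {N : ℕ} (ρ : Op N) : Prop :=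
  ∃ (k : ℕ) (p : Fin k → ℝ) (e f : Fin k → Fin 2 → ℂ) (g : Fin k → Fin N → ℂ),
    (∀ i, 0 ≤ p i) ∧ ∑ i, p i = 1 ∧
    (∀ i, star (e i) ⬝ᵥ e i = 1 ∧ star (f i) ⬝ᵥ f i = 1 ∧ star (g i) ⬝ᵥ g i = 1) ∧
    ρ = ∑ i, (p i : ℂ) •
      Matrix.vecMulVec (productVector (e i) (f i) (g i))
        (star (productVector (e i) (f i) (g i)))

/-- The block row `(CB, C, B, 1)`, whose blocks belong to the basis vectors
`|00⟩, |01⟩, |10⟩, |11⟩` of Alice and Bob. Its conjugate transpose is the block column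
`(B†C†, C†, B†, 1)ᵀ`. -/
def canonicalRow {N : ℕ} (B C : Matrix (Fin N) (Fin N) ℂ) :
    Matrix (Fin N) (Fin 2 × Fin 2 × Fin N) ℂ :=
  Matrix.of fun n x => (![![C * B, C], ![B, 1]] x.1 x.2.1) n x.2.2

/-- An operator on Charlie's space, acting on the whole space as `1 ⊗ 1 ⊗ S`. -/
def onCharlie {N : ℕ} (S : Matrix (Fin N) (Fin N) ℂ) : Op N :=
  (1 : Matrix (Fin 2) (Fin 2) ℂ) ⊗ₖ ((1 : Matrix (Fin 2) (Fin 2) ℂ) ⊗ₖ S)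

/-- The operator `√D (B†C†, C†, B†, 1)ᵀ (CB, C, B, 1) √D`. -/
def canonicalForm {N : ℕ} (B C D : Matrix (Fin N) (Fin N) ℂ) : Op N :=
  onCharlie (CFC.sqrt D) * ((canonicalRow B C)ᴴ * canonicalRow B C) * onCharlie (CFC.sqrt D)

end Tripartite

end

/-! ### Joint diagonalization and growth of rank under perturbation. -/

namespace Tripartite

open Matrix

/-! Rank `N` lets one write `ρ = Y Yᴴ` with `Y` a column of four `N × N` blocks `X a`. Positivity of
the transpose on Charlie says that the matrix with `X b (X a)ᴴ` at place `(a, b)` is positive.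
Together with the full rank of Charlie's reduced state this makes some combination `M` of the blocks
invertible (`exists_isUnit_sum_smul`). For every combination `Z`, a Schur complement then gives `T
Tᴴ ≥ Tᴴ T` with `T = M⁻¹ Z`; both sides have the same trace, so `T` is normal. Polarization and
Fuglede make all `M⁻¹ X a` diagonal in one orthonormal basis, whence `ρ` is a sum of `N` projectors
onto vectors `ψ k ⊗ g k` with the `g k` a basis (`exists_decomposition`).

Contracting Charlie with the dual basis isolates each `ψ k`, and Alice's transpose forces it to be a
product vector. Separability follows by normalizing. For the canonical form, local rotations make
all second components nonzero; these are absorbed into the `g k`, a polar decomposition produces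
`√D`, and the remaining component ratios become, up to conjugation, the eigenvalues of `C` and `B`.
-/

/-- A matrix that commutes with the adjoint of a normal matrix `B` commutes with `B` (Fuglede). -/
theorem commute_of_commute_conjTranspose {n : Type*} [Fintype n] [DecidableEq n]
    {A B : Matrix n n ℂ} (hB : Commute B Bᴴ) (h : Commute A Bᴴ) : Commute A B := by
  -- The operator norm makes matrices a C⋆-algebra, where Fuglede's theorem applies.
  open scoped Matrix.Norms.L2Operator in
  have hn : IsStarNormal Bᴴ := ⟨by simpa [star_eq_conjTranspose] using hB⟩
  open scoped Matrix.Norms.L2Operator in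
  simpa [star_eq_conjTranspose] using (hn.commute_star_left h.symm).symm

/-- Commuting Hermitian matrices have a common unitary diagonalization. -/
theorem exists_unitary_diagonal_of_isHermitian {ι : Type*} {N : ℕ}
    (H : ι → Matrix (Fin N) (Fin N) ℂ) (hH : ∀ a, (H a).IsHermitian)
    (hc : ∀ a b, Commute (H a) (H b)) :
    ∃ W ∈ unitaryGroup (Fin N) ℂ, ∃ d : ι → Fin N → ℂ,
      ∀ a, H a * W = W * diagonal (d a) := by
  classical
  let T : ι → EuclideanSpace ℂ (Fin N) →ₗ[ℂ] EuclideanSpace ℂ (Fin N) :=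
    fun a => Matrix.toEuclideanLin (H a)
  have hT : ∀ a, (T a).IsSymmetric := fun a => Matrix.isSymmetric_toEuclideanLin_iff.mpr (hH a)
  have hTc : ∀ a b, Commute (T a) (T b) := by
    intro a b
    refine LinearMap.ext fun x => ?_
    have := congrArg (fun M => M *ᵥ x.ofLp) (hc a b).eq
    simpa [T, Matrix.toLpLin_apply, ← Matrix.mulVec_mulVec] using this
  let V : (ι → ℂ) → Submodule ℂ (EuclideanSpace ℂ (Fin N)) :=
    fun χ => ⨅ a, Module.End.eigenspace (T a) (χ a)
  have hVo : OrthogonalFamily ℂ (fun χ => V χ) fun χ => (V χ).subtypeₗᵢ :=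
    LinearMap.IsSymmetric.orthogonalFamily_iInf_eigenspaces hT
  have hVt : iSup V = ⊤ :=
    LinearMap.IsSymmetric.iSup_iInf_eq_top_of_commute hT fun a b _ => hTc a b
  have hVi : DirectSum.IsInternal V := by
    rw [OrthogonalFamily.isInternal_iff hVo, hVt, Submodule.top_orthogonal_eq_bot]
  -- The joint eigenvalues `χ` range over an infinite type; an adapted basis needs the finitely many
  -- nonzero joint eigenspaces.
  have hfin : Finite {χ // V χ ≠ ⊥} :=
    (WellFoundedGT.finite_ne_bot_of_iSupIndep hVo.independent).to_subtype
  have : Fintype {χ // V χ ≠ ⊥} := Fintype.ofFinite _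
  have hVi' : DirectSum.IsInternal (fun χ : {χ // V χ ≠ ⊥} => V χ) :=
    DirectSum.isInternal_ne_bot_iff.mpr hVi
  have hVo' := hVo.comp (γ := {χ // V χ ≠ ⊥}) Subtype.val_injective
  have hdim : Module.finrank ℂ (EuclideanSpace ℂ (Fin N)) = N := by simp
  let b := hVi'.subordinateOrthonormalBasis hdim hVo'
  let χ : Fin N → ι → ℂ := fun k => (hVi'.subordinateOrthonormalBasisIndex hdim k hVo').1
  have hb : ∀ k a, T a (b k) = χ k a • b k := fun k a =>
    Module.End.mem_eigenspace_iff.mp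
      ((Submodule.mem_iInf _).mp (hVi'.subordinateOrthonormalBasis_subordinate hdim k hVo') a)
  refine ⟨Matrix.of fun i k => b k i, ?_, fun a k => χ k a, fun a => ?_⟩
  · rw [mem_unitaryGroup_iff']
    ext k l
    have := orthonormal_iff_ite.mp b.orthonormal k l
    rw [star_eq_conjTranspose, mul_apply, one_apply, ← this, PiLp.inner_apply]
    simp [mul_comm]
  · ext i k
    have := congrArg (fun v => v.ofLp i) (hb k a)
    rw [mul_diagonal, mul_apply]
    simpa [T, Matrix.toLpLin_apply, mulVec, dotProduct, mul_comm] using this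

/-- Matrices that commute with each other's adjoints have a common unitary diagonalization. -/
theorem exists_unitary_diagonal {ι : Type*} {N : ℕ}
    (A : ι → Matrix (Fin N) (Fin N) ℂ) (h : ∀ a b, Commute (A a) (A b)ᴴ) :
    ∃ W ∈ unitaryGroup (Fin N) ℂ, ∃ d : ι → Fin N → ℂ,
      ∀ a, A a * W = W * diagonal (d a) := by
  have h1 : ∀ a b, Commute (A a) (A b) := fun a b =>
    commute_of_commute_conjTranspose (h b b) (h a b)
  have h2 : ∀ a b, Commute (A a)ᴴ (A b)ᴴ := fun a b => by
    have := congrArg conjTranspose (h1 b a).eq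
    simpa [Commute, SemiconjBy] using this
  have h3 : ∀ a b, Commute (A a)ᴴ (A b) := fun a b => (h b a).symm
  -- Each matrix is split into its Hermitian and anti-Hermitian parts, the latter made Hermitian by
  -- the factor `i`.
  obtain ⟨W, hW, d, hd⟩ := exists_unitary_diagonal_of_isHermitian
    (fun x : ι × Bool => if x.2 then A x.1 + (A x.1)ᴴ else Complex.I • (A x.1 - (A x.1)ᴴ))
    (by
      rintro ⟨a, _ | _⟩
      · change (Complex.I • (A a - (A a)ᴴ))ᴴ = Complex.I • (A a - (A a)ᴴ)
        rw [conjTranspose_smul, conjTranspose_sub, conjTranspose_conjTranspose, Complex.star_def,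
          Complex.conj_I, neg_smul, ← smul_neg, neg_sub]
      · change (A a + (A a)ᴴ)ᴴ = A a + (A a)ᴴ
        rw [conjTranspose_add, conjTranspose_conjTranspose, add_comm])
    (by
      have key : ∀ a b, ∀ s t : ℂ, Commute (A a + s • (A a)ᴴ) (A b + t • (A b)ᴴ) := fun a b s t =>
        .add_left (.add_right (h1 a b) ((h a b).smul_right t))
          (.add_right ((h3 a b).smul_left s) (((h2 a b).smul_right t).smul_left s))
      rintro ⟨a, _ | _⟩ ⟨b, _ | _⟩
      · change Commute (Complex.I • (A a - (A a)ᴴ)) (Complex.I • (A b - (A b)ᴴ))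
        have := ((key a b (-1) (-1)).smul_left Complex.I).smul_right Complex.I
        rwa [neg_one_smul, neg_one_smul, ← sub_eq_add_neg, ← sub_eq_add_neg] at this
      · change Commute (Complex.I • (A a - (A a)ᴴ)) (A b + (A b)ᴴ)
        have := (key a b (-1) 1).smul_left Complex.I
        rwa [neg_one_smul, one_smul, ← sub_eq_add_neg] at this
      · change Commute (A a + (A a)ᴴ) (Complex.I • (A b - (A b)ᴴ))
        have := (key a b 1 (-1)).smul_right Complex.I
        rwa [neg_one_smul, one_smul, ← sub_eq_add_neg] at this
      · change Commute (A a + (A a)ᴴ) (A b + (A b)ᴴ)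
        have := key a b 1 1
        rwa [one_smul, one_smul] at this)
  refine ⟨W, hW, fun a k => (d (a, true) k - Complex.I * d (a, false) k) / 2, fun a => ?_⟩
  have e1 := hd (a, true)
  have e2 := hd (a, false)
  simp only [if_true, Bool.false_eq_true, if_false] at e1 e2
  have e3 : A a = (1 / 2 : ℂ) • ((A a + (A a)ᴴ) - Complex.I • Complex.I • (A a - (A a)ᴴ)) := by
    rw [smul_smul, Complex.I_mul_I]
    module
  rw [e3, smul_mul_assoc, sub_mul, e1, smul_mul_assoc, e2]
  ext i k
  simp [mul_diagonal]
  ring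

/-- If `X w = 0` but `Y w` is not in the range of `X`, some `X + t Y` has larger rank than `X`. -/
theorem exists_rank_lt_rank_add_smul {n : Type*} [Fintype n] [DecidableEq n]
    (X Y : Matrix n n ℂ) (w : n → ℂ) (hw : X *ᵥ w = 0)
    (hY : Y *ᵥ w ∉ LinearMap.range X.mulVecLin) : ∃ t : ℂ, X.rank < (X + t • Y).rank := by
  let b := Module.finBasis ℂ (LinearMap.range X.mulVecLin)
  choose u hu using fun i => (b i).2
  -- At `t = 0` this is a basis of the range of `X` together with `Y w`. Independence is an open
  -- condition, so it persists for small `t ≠ 0`, where `Y w = (X + t Y)(t⁻¹ w)` also lies in the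
  -- range.
  let F : ℂ → Option (Fin (Module.finrank ℂ (LinearMap.range X.mulVecLin))) → n → ℂ :=
    fun t o => o.elim (Y *ᵥ w) fun i => (X + t • Y) *ᵥ u i
  have hF0 : LinearIndependent ℂ (F 0) := by
    rw [linearIndependent_option]
    have hs : (F 0 ∘ some) = fun i => (b i : n → ℂ) := by
      funext i
      simpa [F] using hu i
    have hspan : Submodule.span ℂ (Set.range (F 0 ∘ some)) ≤ LinearMap.range X.mulVecLin := by
      rw [Submodule.span_le, hs]
      rintro _ ⟨i, rfl⟩
      exact (b i).2
    constructor
    · rw [hs]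
      exact b.linearIndependent.map' (Submodule.subtype _) (Submodule.ker_subtype _)
    · exact fun hmem => hY (hspan hmem)
  have hcont : Continuous F := by
    refine continuous_pi fun o => ?_
    cases o with
    | none => exact continuous_const
    | some i =>
      simp only [F, Option.elim, add_mulVec, smul_mulVec]
      fun_prop
  have hev := hcont.continuousAt.eventually hF0.eventually
  obtain ⟨t, ht, ht0⟩ := ((hev.filter_mono nhdsWithin_le_nhds).and
    (self_mem_nhdsWithin (a := (0 : ℂ)) (s := {0}ᶜ))).exists
  refine ⟨t, ?_⟩
  have hle : Submodule.span ℂ (Set.range (F t)) ≤ LinearMap.range (X + t • Y).mulVecLin := by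
    rw [Submodule.span_le]
    rintro _ ⟨o, rfl⟩
    cases o with
    | none =>
      refine ⟨t⁻¹ • w, ?_⟩
      have ht0' : t ≠ 0 := ht0
      simp [F, add_mulVec, hw, smul_mulVec, smul_smul, ht0']
    | some i => exact ⟨u i, rfl⟩
  have hcard := finrank_span_eq_card ht
  rw [Fintype.card_option, Fintype.card_fin] at hcard
  have hmono := Submodule.finrank_mono (R := ℂ) hle
  rw [hcard] at hmono
  exact hmono

end Tripartite

/-! ### Decomposition across the cut between `AB` and `C`. -/

namespace Tripartite

open Matrix

/-- A positive semidefinite matrix of rank `N` factors through `ℂᴺ`. -/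
theorem exists_eq_mul_conjTranspose {m : Type*} [Fintype m] [DecidableEq m] {N : ℕ}
    {ρ : Matrix m m ℂ} (h : ρ.PosSemidef) (hr : ρ.rank = N) :
    ∃ Y : Matrix m (Fin N) ℂ, ρ = Y * Yᴴ := by
  let ev := h.1.eigenvalues
  have hcard : Fintype.card {i // ev i ≠ 0} = N := h.1.rank_eq_card_non_zero_eigs ▸ hr
  let e : Fin N ≃ {i // ev i ≠ 0} := (Fintype.equivFinOfCardEq hcard).symm
  let u := h.1.eigenvectorUnitary
  refine ⟨of fun x k => (u : Matrix m m ℂ) x (e k) * (Real.sqrt (ev (e k)) : ℂ), ?_⟩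
  have hs : ρ = (u : Matrix m m ℂ) * diagonal (fun i => (ev i : ℂ)) * (u : Matrix m m ℂ)ᴴ := by
    simpa [Unitary.conjStarAlgAut_apply, star_eq_conjTranspose, Function.comp_def] using
      h.1.spectral_theorem
  conv_lhs => rw [hs]
  ext x y
  rw [mul_apply, mul_apply]
  simp only [mul_diagonal, conjTranspose_apply, of_apply]
  have h0 : ∀ i, i ∉ Set.range (fun k => (e k : m)) →
      (u : Matrix m m ℂ) x i * (ev i : ℂ) * star ((u : Matrix m m ℂ) y i) = 0 := by
    intro i hi
    have : ev i = 0 := by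
      by_contra hne
      exact hi ⟨e.symm ⟨i, hne⟩, by simp⟩
    simp [this]
  rw [← Fintype.sum_of_injective (fun k => (e k : m))
    (Subtype.val_injective.comp e.injective) _ _ h0 (fun k => rfl)]
  refine Finset.sum_congr rfl fun k _ => ?_
  have : ((Real.sqrt (ev (e k)) : ℝ) : ℂ) * (Real.sqrt (ev (e k)) : ℝ) = (ev (e k) : ℂ) := by
    rw [← Complex.ofReal_mul, Real.mul_self_sqrt (h.eigenvalues_nonneg _)]
  simp only [star_mul', Complex.star_def, Complex.conj_ofReal]
  rw [← this]
  ring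

section Blocks

variable {ι n : Type*} [Fintype ι] [Fintype n] [DecidableEq n]

/-- The partial transpose over the index set `ι` of the matrix with blocks `X a * (X b)ᴴ`. -/
def blockTranspose (X : ι → Matrix n n ℂ) : Matrix (ι × n) (ι × n) ℂ :=
  of fun x y => (X y.1 * (X x.1)ᴴ) x.2 y.2

/-- Linear combinations of the blocks of a positive block transpose form positive `2 × 2` block
matrices. -/
theorem posSemidef_fromBlocks_of_blockTranspose {X : ι → Matrix n n ℂ}
    (hX : (blockTranspose X).PosSemidef) (c d : ι → ℂ) :
    (fromBlocks ((∑ a, d a • X a) * (∑ a, d a • X a)ᴴ) ((∑ a, c a • X a) * (∑ a, d a • X a)ᴴ)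
      ((∑ a, d a • X a) * (∑ a, c a • X a)ᴴ)
      ((∑ a, c a • X a) * (∑ a, c a • X a)ᴴ)).PosSemidef := by
  -- Compression by `S`: because of the transpose, the conjugated coefficients meet the adjoint
  -- factors, so the double sums reassemble into products of combinations.
  let f : ι → n ⊕ n → ℂ := fun a => Sum.elim (fun _ => d a) fun _ => c a
  let p : n ⊕ n → n := Sum.elim id id
  let S : Matrix (ι × n) (n ⊕ n) ℂ := of fun x s => if x.2 = p s then f x.1 s else 0
  have key : ∀ s t, (Sᴴ * blockTranspose X * S) s t =
      ∑ a, ∑ b, star (f a s) * f b t * (X b * (X a)ᴴ) (p s) (p t) := by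
    intro s t
    simp only [mul_apply (M := Sᴴ * blockTranspose X), mul_apply (M := Sᴴ), Finset.sum_mul,
      Fintype.sum_prod_type]
    rw [Finset.sum_congr rfl fun b _ => Finset.sum_comm, Finset.sum_comm]
    refine Finset.sum_congr rfl fun a _ => Finset.sum_congr rfl fun b _ => ?_
    simp [S, conjTranspose_apply, apply_ite star, blockTranspose]
    ring
  have expand : ∀ (u v : ι → ℂ) (i j : n), ((∑ b, u b • X b) * (∑ a, v a • X a)ᴴ) i j =
      ∑ a, ∑ b, star (v a) * u b * (X b * (X a)ᴴ) i j := by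
    intro u v i j
    rw [conjTranspose_sum, Finset.mul_sum, Matrix.sum_apply]
    refine Finset.sum_congr rfl fun a _ => ?_
    rw [Finset.sum_mul, Matrix.sum_apply]
    refine Finset.sum_congr rfl fun b _ => ?_
    rw [conjTranspose_smul, smul_mul_smul_comm, Matrix.smul_apply, smul_eq_mul, mul_comm (u b)]
  convert! hX.conjTranspose_mul_mul_same S using 1
  ext s t
  rw [key]
  rcases s with i | i <;> rcases t with j | j <;> simp only [fromBlocks_apply₁₁,
    fromBlocks_apply₁₂, fromBlocks_apply₂₁, fromBlocks_apply₂₂, expand] <;> rfl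

/-- If the block transpose is positive and the blocks have no common left kernel vector, some
linear combination of the blocks is invertible. -/
theorem exists_isUnit_sum_smul {X : ι → Matrix n n ℂ} (hX : (blockTranspose X).PosSemidef)
    (hker : ∀ v : n → ℂ, (∀ a, (X a)ᴴ *ᵥ v = 0) → v = 0) :
    ∃ c : ι → ℂ, IsUnit (∑ a, c a • X a) := by
  classical
  -- A combination of maximal rank is the candidate.
  obtain ⟨c, hc⟩ : ∃ c : ι → ℂ, ∀ d : ι → ℂ,
      (∑ a, d a • X a).rank ≤ (∑ a, c a • X a).rank := by
    have hbdd : BddAbove (Set.range fun c : ι → ℂ => (∑ a, c a • X a).rank) :=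
      ⟨Fintype.card n, by rintro _ ⟨c, rfl⟩; exact rank_le_card_width _⟩
    obtain ⟨c, hc⟩ := Nat.sSup_mem (Set.range_nonempty _) hbdd
    exact ⟨c, fun d => by
      have := le_csSup hbdd ⟨d, rfl⟩
      rw [← hc] at this
      exact this⟩
  refine ⟨c, ?_⟩
  set M := ∑ a, c a • X a with hM
  suffices h : ∀ v, Mᴴ *ᵥ v = 0 → v = 0 by
    rw [← isUnit_conjTranspose, ← mulVec_injective_iff_isUnit]
    exact (injective_iff_map_eq_zero Mᴴ.mulVecLin).mpr h
  intro v hv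
  refine hker v fun b => ?_
  have hw : M *ᵥ ((X b)ᴴ *ᵥ v) = 0 := by
    have hP := posSemidef_fromBlocks_of_blockTranspose hX c (Pi.single b 1)
    have hsingle : ∑ a, (Pi.single b 1 : ι → ℂ) a • X a = X b := by
      simp [Pi.single_apply]
    rw [hsingle, ← hM] at hP
    -- The form vanishes at `(0, v)`, so this vector is in the kernel; the upper row reads `M (X b)ᴴ
    -- v = 0`.
    have := (hP.dotProduct_mulVec_zero_iff (Sum.elim 0 v)).mp (by
      simp [fromBlocks_mulVec, ← mulVec_mulVec, hv, dotProduct])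
    simp only [fromBlocks_mulVec] at this
    have := congrArg (fun f => f ∘ Sum.inl) this
    simpa [mulVec_mulVec] using this
  -- The range of `M` is orthogonal to `v`, but `X b (X b)ᴴ v` pairs with `v` to `‖(X b)ᴴ v‖² ≠ 0`.
  -- The rank could then grow, against maximality.
  by_contra hne
  obtain ⟨t, ht⟩ := exists_rank_lt_rank_add_smul M (X b) _ hw (by
    rintro ⟨z, hz⟩
    apply hne
    rw [← dotProduct_star_self_eq_zero, star_mulVec, conjTranspose_conjTranspose, ← dotProduct_mulVec, ← hz, mulVecLin_apply,
      dotProduct_mulVec, ← conjTranspose_conjTranspose M, ← star_mulVec, hv]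
    simp)
  have := hc (c + t • Pi.single b 1)
  simp only [Pi.add_apply, Pi.smul_apply, add_smul, Finset.sum_add_distrib, ← hM, smul_assoc,
    ← Finset.smul_sum] at this
  simp only [Pi.single_apply, ite_smul, one_smul, zero_smul, Finset.sum_ite_eq',
    Finset.mem_univ, if_true] at this
  exact absurd ht this.not_gt

/-- If all linear combinations of matrices are normal, the matrices commute with each other's
adjoints. -/
theorem commute_conjTranspose_of_forall_normal {A : ι → Matrix n n ℂ}
    (h : ∀ d : ι → ℂ, Commute (∑ a, d a • A a) (∑ a, d a • A a)ᴴ) (a b : ι) :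
    Commute (A a) (A b)ᴴ := by
  classical
  have hs : ∀ t : ℂ, ∑ x, (Pi.single a 1 + t • Pi.single b 1 : ι → ℂ) x • A x =
      A a + t • A b := fun t => by
    simp only [Pi.add_apply, Pi.smul_apply, add_smul, Finset.sum_add_distrib, smul_assoc,
      ← Finset.smul_sum]
    simp [Pi.single_apply]
  have h0 := fun t => hs t ▸ h (Pi.single a 1 + t • Pi.single b 1)
  have ha := (h0 0).eq
  have hb : A b * (A b)ᴴ = (A b)ᴴ * A b := by
    have := (h (Pi.single b 1)).eq
    simpa [Pi.single_apply] using this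
  have h1 := (h0 1).eq
  have hI := (h0 Complex.I).eq
  simp only [zero_smul, add_zero, one_smul, conjTranspose_add, conjTranspose_smul, add_mul,
    mul_add, smul_mul_assoc, mul_smul_comm, Complex.star_def, Complex.conj_I,
    hb] at ha h1 hI
  rw [ha] at h1 hI
  -- Normality at `t = 1` and `t = i` yields the sum and the difference of the two mixed
  -- commutators.
  have e1 : A a * (A b)ᴴ - (A b)ᴴ * A a + (A b * (A a)ᴴ - (A a)ᴴ * A b) = 0 := by
    rw [← sub_eq_zero] at h1
    rw [← h1]
    abel
  have e2 : A a * (A b)ᴴ - (A b)ᴴ * A a - (A b * (A a)ᴴ - (A a)ᴴ * A b) = 0 := by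
    rw [← sub_eq_zero] at hI
    have := congrArg (fun Z => Complex.I • Z) hI
    simp only [smul_zero] at this
    rw [← this]
    match_scalars <;> simp
  have e3 : (2 : ℂ) • (A a * (A b)ᴴ - (A b)ᴴ * A a) = 0 := by
    have := congrArg₂ (· + ·) e1 e2
    simp only [add_zero] at this
    rw [← this]
    module
  exact sub_eq_zero.mp ((smul_eq_zero.mp e3).resolve_left two_ne_zero)

/-- Blocks with positive block transpose, divided by an invertible linear combination of them,
commute with each other's adjoints. -/
theorem commute_conjTranspose_of_blockTranspose {X : ι → Matrix n n ℂ}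
    (hX : (blockTranspose X).PosSemidef) {c : ι → ℂ} (hc : IsUnit (∑ a, c a • X a)) (a b : ι) :
    Commute ((∑ a, c a • X a)⁻¹ * X a) ((∑ a, c a • X a)⁻¹ * X b)ᴴ := by
  set M := ∑ a, c a • X a with hM
  have hdet : IsUnit M.det := (isUnit_iff_isUnit_det M).mp hc
  refine commute_conjTranspose_of_forall_normal (A := fun a => M⁻¹ * X a) (fun d => ?_) a b
  have hsum : ∑ a, d a • (M⁻¹ * X a) = M⁻¹ * ∑ a, d a • X a := by
    simp [Finset.mul_sum]
  rw [hsum]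
  set Z := ∑ a, d a • X a
  have hP := (posSemidef_fromBlocks_of_blockTranspose hX c d).mul_mul_conjTranspose_same
    (fromBlocks M⁻¹ 0 0 M⁻¹)
  rw [← hM] at hP
  have h1 : M⁻¹ * M = 1 := nonsing_inv_mul _ hdet
  have h2 : Mᴴ * (M⁻¹)ᴴ = 1 := by rw [← conjTranspose_mul, h1, conjTranspose_one]
  have hB : fromBlocks M⁻¹ 0 0 M⁻¹ * fromBlocks (Z * Zᴴ) (M * Zᴴ) (Z * Mᴴ) (M * Mᴴ) *
      (fromBlocks M⁻¹ 0 0 M⁻¹)ᴴ = fromBlocks (M⁻¹ * Z * (M⁻¹ * Z)ᴴ) (M⁻¹ * Z)ᴴ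
        ((M⁻¹ * Z)ᴴ)ᴴ 1 := by
    rw [fromBlocks_conjTranspose, fromBlocks_multiply, fromBlocks_multiply]
    simp only [Matrix.zero_mul, Matrix.mul_zero, add_zero, zero_add, conjTranspose_zero,
      conjTranspose_mul, Matrix.mul_assoc, h2, Matrix.mul_one, conjTranspose_conjTranspose]
    simp only [← Matrix.mul_assoc, h1, Matrix.one_mul]
  rw [hB] at hP
  have hone : (1 : Matrix n n ℂ).PosDef := PosDef.one
  have : Invertible (1 : Matrix n n ℂ) := invertibleOne
  rw [PosDef.fromBlocks₂₂ _ _ hone] at hP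
  simp only [inv_one, Matrix.mul_one, conjTranspose_conjTranspose] at hP
  -- The Schur complement of the identity block is a positive self-commutator; having trace zero, it
  -- vanishes.
  have htr : (M⁻¹ * Z * (M⁻¹ * Z)ᴴ - (M⁻¹ * Z)ᴴ * (M⁻¹ * Z)).trace = 0 := by
    rw [trace_sub, trace_mul_comm, sub_self]
  exact sub_eq_zero.mp (hP.trace_eq_zero_iff.mp htr)

end Blocks

/-- A state whose rank equals the rank of Charlie's reduced state, with positive partial transpose
with respect to Charlie, is a mixture of product vectors between `AB` and `C`, with linearly
independent vectors on Charlie's side. -/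
theorem exists_decomposition {N : ℕ} {ρ : Op N} (hρ : ρ.PosSemidef)
    (hC : (partialTransposeC ρ).PosSemidef) (hs : (reducedC ρ).rank = N) (hr : ρ.rank = N) :
    ∃ G : Matrix (Fin N) (Fin N) ℂ, IsUnit G ∧ ∃ ψ : Fin N → Fin 2 → Fin 2 → ℂ,
      (∀ k, ψ k ≠ 0) ∧ ∀ x y, ρ x y =
        ∑ k, (ψ k x.1 x.2.1 * G x.2.2 k) * star (ψ k y.1 y.2.1 * G y.2.2 k) := by
  obtain ⟨Y, hY⟩ := exists_eq_mul_conjTranspose hρ hr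
  let X : Fin 2 × Fin 2 → Matrix (Fin N) (Fin N) ℂ := fun a => of fun i k => Y (a.1, a.2, i) k
  have hρX : ∀ x y, ρ x y = (X (x.1, x.2.1) * (X (y.1, y.2.1))ᴴ) x.2.2 y.2.2 := by
    intro x y
    conv_lhs => rw [hY]
    rfl
  have hX : (blockTranspose X).PosSemidef := by
    -- A full transpose turns the transpose on `C` into the one on `AB`.
    convert! hC.transpose.submatrix
      (fun x : (Fin 2 × Fin 2) × Fin N => (x.1.1, x.1.2, x.2)) using 1
    ext x y
    simp [blockTranspose, partialTransposeC, hρX]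
  have hred : reducedC ρ = ∑ a, X a * (X a)ᴴ := by
    ext i j
    simp [reducedC, hρX, Matrix.sum_apply, Fintype.sum_prod_type]
  have hker : ∀ v : Fin N → ℂ, (∀ a, (X a)ᴴ *ᵥ v = 0) → v = 0 := by
    intro v hv
    have hu : IsUnit (reducedC ρ) := by
      rw [← mulVec_surjective_iff_isUnit]
      refine (LinearMap.range_eq_top (f := (reducedC ρ).mulVecLin)).mp
        (Submodule.eq_top_of_finrank_eq ?_)
      rw [Module.finrank_fin_fun]
      exact hs
    refine mulVec_injective_iff_isUnit.mpr hu ?_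
    simp [hred, sum_mulVec, ← mulVec_mulVec, hv]
  obtain ⟨c, hc⟩ := exists_isUnit_sum_smul hX hker
  obtain ⟨W, hW, d, hd⟩ := exists_unitary_diagonal _
    (commute_conjTranspose_of_blockTranspose hX hc)
  set M := ∑ a, c a • X a with hM
  have hdet : IsUnit M.det := (isUnit_iff_isUnit_det M).mp hc
  have hWW : W * Wᴴ = 1 := mem_unitaryGroup_iff.mp hW
  have hWu : IsUnit W := ⟨⟨W, Wᴴ, hWW, mem_unitaryGroup_iff'.mp hW⟩, rfl⟩
  have hXd : ∀ a, X a = M * W * diagonal (d a) * Wᴴ := by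
    intro a
    rw [Matrix.mul_assoc M, ← hd, ← Matrix.mul_assoc, Matrix.mul_assoc _ W, hWW,
      mul_nonsing_inv_cancel_left _ _ hdet, Matrix.mul_one]
  have hWd : W * diagonal (fun k => ∑ a, c a * d a k) = W := by
    have h1 : ∑ a, c a • (M⁻¹ * X a) = 1 := by
      rw [← nonsing_inv_mul _ hdet, hM, Finset.mul_sum]
      simp
    have h2 : (∑ a, c a • (M⁻¹ * X a)) * W = W * diagonal (fun k => ∑ a, c a * d a k) := by
      rw [Finset.sum_mul]
      simp only [smul_mul_assoc, hd]
      ext i k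
      simp [Matrix.sum_apply, mul_diagonal, Finset.mul_sum, mul_left_comm]
    rw [← h2, h1, Matrix.one_mul]
  have hsum : ∀ k, ∑ a, c a * d a k = 1 := by
    -- The normalization `∑ c a (M⁻¹ X a) = 1`, read on eigenvalues, is what keeps each `ψ k`
    -- nonzero.
    have h1 : diagonal (fun k => ∑ a, c a * d a k) = 1 :=
      hWu.mul_left_cancel (hWd.trans (Matrix.mul_one W).symm)
    intro k
    simpa using congrFun (congrFun h1 k) k
  refine ⟨M * W, hc.mul hWu, fun k i j => d (i, j) k, fun k hk => ?_, fun x y => ?_⟩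
  · have h1 := hsum k
    have : ∀ a, d a k = 0 := fun a => congrFun (congrFun hk a.1) a.2
    simp [this] at h1
  · have hWW' : Wᴴ * W = 1 := mem_unitaryGroup_iff'.mp hW
    have : X (x.1, x.2.1) * (X (y.1, y.2.1))ᴴ =
        (M * W * diagonal (d (x.1, x.2.1))) * (M * W * diagonal (d (y.1, y.2.1)))ᴴ := by
      rw [hXd, hXd, conjTranspose_mul _ Wᴴ, conjTranspose_conjTranspose, Matrix.mul_assoc,
        ← Matrix.mul_assoc Wᴴ, hWW', Matrix.one_mul]
    rw [hρX, this, mul_apply]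
    simp only [conjTranspose_apply, mul_diagonal]
    exact Finset.sum_congr rfl fun k _ => by rw [mul_comm (d _ k), mul_comm (d _ k)]

end Tripartite

/-! ### Product vectors, separability and the canonical form. -/

namespace Tripartite

open Matrix

/-- A vector of `ℂ² ⊗ ℂ²` whose projector has a positive partial transpose has vanishing
determinant. -/
theorem mul_eq_mul_of_posSemidef_partialTranspose {ψ : Fin 2 → Fin 2 → ℂ}
    (h : (of fun p q : Fin 2 × Fin 2 => ψ q.1 p.2 * star (ψ p.1 q.2)).PosSemidef) :
    ψ 0 0 * ψ 1 1 = ψ 0 1 * ψ 1 0 := by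
  -- Row `i` of the test vector is chosen so that its pairing with row `i'` of `ψ` is a `2 × 2`
  -- minor; the form then equals `-2 |det ψ|²`.
  have h1 := h.dotProduct_mulVec_nonneg (fun p => ![![star (ψ 0 1), -star (ψ 0 0)],
    ![star (ψ 1 1), -star (ψ 1 0)]] p.1 p.2)
  have h2 : star (fun p : Fin 2 × Fin 2 => ![![star (ψ 0 1), -star (ψ 0 0)],
      ![star (ψ 1 1), -star (ψ 1 0)]] p.1 p.2) ⬝ᵥ
      ((of fun p q : Fin 2 × Fin 2 => ψ q.1 p.2 * star (ψ p.1 q.2)) *ᵥ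
        fun p => ![![star (ψ 0 1), -star (ψ 0 0)], ![star (ψ 1 1), -star (ψ 1 0)]] p.1 p.2) =
      -2 * ((ψ 0 0 * ψ 1 1 - ψ 0 1 * ψ 1 0) * star (ψ 0 0 * ψ 1 1 - ψ 0 1 * ψ 1 0)) := by
    simp [dotProduct, mulVec, Fintype.sum_prod_type]
    ring
  rw [h2, Complex.star_def, Complex.mul_conj] at h1
  have h3 : 0 ≤ -2 * Complex.normSq (ψ 0 0 * ψ 1 1 - ψ 0 1 * ψ 1 0) := by exact_mod_cast h1
  have h4 := Complex.normSq_nonneg (ψ 0 0 * ψ 1 1 - ψ 0 1 * ψ 1 0)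
  exact sub_eq_zero.mp (Complex.normSq_eq_zero.mp (by linarith))

/-- A vector of `ℂ² ⊗ ℂ²` with vanishing determinant is a product vector. -/
theorem exists_eq_mul_of_mul_eq_mul {ψ : Fin 2 → Fin 2 → ℂ}
    (h : ψ 0 0 * ψ 1 1 = ψ 0 1 * ψ 1 0) : ∃ e f : Fin 2 → ℂ, ∀ i j, ψ i j = e i * f j := by
  by_cases h0 : ψ 0 = 0
  · refine ⟨![0, 1], ψ 1, fun i j => ?_⟩
    fin_cases i <;> simp [h0]
  · obtain ⟨l, hl⟩ := Function.ne_iff.mp h0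
    have hl' : ψ 0 l ≠ 0 := hl
    refine ⟨![1, ψ 1 l / ψ 0 l], ψ 0, fun i j => ?_⟩
    fin_cases i
    · simp
    · simp only [Fin.mk_one, cons_val_one, cons_val_fin_one]
      field_simp
      fin_cases l <;> fin_cases j <;> simp at * <;> first | linear_combination h | linear_combination -h

/-- The matrix with columns `e k ⊗ f k ⊗ g k`, where `g k` is the `k`-th column of `G`. -/
def productMatrix {N : ℕ} (e f : Fin N → Fin 2 → ℂ) (G : Matrix (Fin N) (Fin N) ℂ) :
    Matrix (Fin 2 × Fin 2 × Fin N) (Fin N) ℂ :=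
  of fun x k => e k x.1 * f k x.2.1 * G x.2.2 k

/-- A PPT state of rank `N` supported on `ℂ² ⊗ ℂ² ⊗ ℂᴺ` is a sum of `N` projectors onto product
vectors that are linearly independent on Charlie's side. -/
theorem exists_eq_productMatrix_mul {N : ℕ} {ρ : Op N} (hρ : ρ.PosSemidef) (hppt : IsPPT ρ)
    (hs : (reducedC ρ).rank = N) (hr : ρ.rank = N) :
    ∃ (G : Matrix (Fin N) (Fin N) ℂ) (e f : Fin N → Fin 2 → ℂ), IsUnit G ∧
      (∀ k, e k ≠ 0) ∧ (∀ k, f k ≠ 0) ∧ ρ = productMatrix e f G * (productMatrix e f G)ᴴ := by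
  obtain ⟨G, hG, ψ, hψ, hρψ⟩ := exists_decomposition hρ hppt.2.2 hs hr
  have hG1 : G⁻¹ * G = 1 := nonsing_inv_mul _ ((isUnit_iff_isUnit_det G).mp hG)
  have hprod : ∀ k, ∃ e f : Fin 2 → ℂ, ∀ i j, ψ k i j = e i * f j := by
    intro k
    apply exists_eq_mul_of_mul_eq_mul
    apply mul_eq_mul_of_posSemidef_partialTranspose
    -- Row `k` of `G⁻¹` is dual to the columns of `G`, so this contraction of Charlie kills all
    -- terms but the `k`-th.
    let S : Matrix (Fin 2 × Fin 2 × Fin N) (Fin 2 × Fin 2) ℂ :=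
      of fun x p => if (x.1, x.2.1) = p then star (G⁻¹ k x.2.2) else 0
    convert! hppt.1.conjTranspose_mul_mul_same S using 1
    ext p q
    have hentry : (Sᴴ * partialTransposeA ρ * S) p q =
        ∑ n, ∑ m, G⁻¹ k m * ρ (q.1, p.2, m) (p.1, q.2, n) * star (G⁻¹ k n) := by
      simp only [mul_apply (M := Sᴴ * partialTransposeA ρ), mul_apply (M := Sᴴ), Finset.sum_mul]
      have hS : ∀ x p, S x p = if (x.1, x.2.1) = p then star (G⁻¹ k x.2.2) else 0 :=
        fun _ _ => rfl
      obtain ⟨i, j⟩ := p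
      obtain ⟨i', j'⟩ := q
      simp only [conjTranspose_apply, hS, Fintype.sum_prod_type, partialTransposeA, of_apply,
        Prod.mk.injEq]
      fin_cases i <;> fin_cases j <;> fin_cases i' <;> fin_cases j' <;> simp
    have hδ : ∀ l, ∑ m, G⁻¹ k m * G m l = if k = l then 1 else 0 := fun l => by
      rw [← mul_apply, hG1, one_apply]
    rw [hentry]
    have : ∀ n m, G⁻¹ k m * ρ (q.1, p.2, m) (p.1, q.2, n) * star (G⁻¹ k n) =
        ∑ l, (ψ l q.1 p.2 * star (ψ l p.1 q.2)) * (G⁻¹ k m * G m l) *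
          star (G⁻¹ k n * G n l) := by
      intro n m
      rw [hρψ, Finset.mul_sum, Finset.sum_mul]
      refine Finset.sum_congr rfl fun l _ => ?_
      simp only [star_mul']
      ring
    simp only [this]
    rw [Finset.sum_congr rfl fun n _ => Finset.sum_comm, Finset.sum_comm]
    simp only [← Finset.sum_mul, ← Finset.mul_sum, ← star_sum, hδ]
    simp
  choose e f hef using hprod
  refine ⟨G, e, f, hG, fun k hk => hψ k ?_, fun k hk => hψ k ?_, ?_⟩
  · ext i j
    simp [hef, hk]
  · ext i j
    simp [hef, hk]
  · ext x y
    rw [hρψ, mul_apply]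
    simp [productMatrix, hef]

/-- A nonzero vector is a real multiple of a unit vector. -/
theorem exists_eq_smul_unit {m : Type*} [Fintype m] {v : m → ℂ} (hv : v ≠ 0) :
    ∃ (r : ℝ) (u : m → ℂ), star u ⬝ᵥ u = 1 ∧ v = (r : ℂ) • u := by
  have hpos : 0 < star v ⬝ᵥ v := dotProduct_star_self_pos_iff.mpr hv
  obtain ⟨s, hs⟩ : ∃ s : ℝ, star v ⬝ᵥ v = (s : ℂ) :=
    ⟨_, (Complex.eq_re_of_ofReal_le hpos.le)⟩
  rw [hs] at hpos
  have hs0 : 0 < s := by exact_mod_cast hpos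
  have hne : (Real.sqrt s : ℂ) ≠ 0 := by exact_mod_cast (Real.sqrt_pos.mpr hs0).ne'
  refine ⟨Real.sqrt s, (Real.sqrt s : ℂ)⁻¹ • v, ?_, (smul_inv_smul₀ hne v).symm⟩
  have hsq : (Real.sqrt s : ℂ) * Real.sqrt s = s := by
    exact_mod_cast Real.mul_self_sqrt hs0.le
  rw [star_smul, smul_dotProduct, dotProduct_smul, hs, ← hsq]
  simp only [star_inv₀, Complex.star_def, Complex.conj_ofReal, smul_eq_mul]
  field_simp

/-- A trace-one sum of projectors onto nonzero product vectors is fully separable. -/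
theorem isSeparable_of_eq_productMatrix_mul {N : ℕ} {ρ : Op N} (htr : ρ.trace = 1)
    {G : Matrix (Fin N) (Fin N) ℂ} {e f : Fin N → Fin 2 → ℂ} (hG : IsUnit G)
    (he : ∀ k, e k ≠ 0) (hf : ∀ k, f k ≠ 0)
    (hρ : ρ = productMatrix e f G * (productMatrix e f G)ᴴ) : IsSeparable ρ := by
  have hg : ∀ k, (fun i => G i k) ≠ 0 := by
    intro k hk
    have h1 : G⁻¹ * G = 1 := nonsing_inv_mul _ ((isUnit_iff_isUnit_det G).mp hG)
    have h2 := congrFun (congrFun h1 k) k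
    have h3 : ∀ i, G i k = 0 := fun i => congrFun hk i
    simp [mul_apply, h3] at h2
  choose a e' he1 hea using fun k => exists_eq_smul_unit (he k)
  choose b f' hf1 hfb using fun k => exists_eq_smul_unit (hf k)
  choose c g' hg1 hgc using fun k => exists_eq_smul_unit (hg k)
  have hsum : ρ = ∑ k, (((a k * b k * c k) ^ 2 : ℝ) : ℂ) •
      vecMulVec (productVector (e' k) (f' k) (g' k))
        (star (productVector (e' k) (f' k) (g' k))) := by
    rw [hρ]
    ext x y
    rw [mul_apply, Matrix.sum_apply]
    refine Finset.sum_congr rfl fun k _ => ?_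
    have h3 : ∀ i, G i k = (c k : ℂ) * g' k i := fun i => congrFun (hgc k) i
    simp only [conjTranspose_apply, productMatrix, of_apply, h3, Matrix.smul_apply, vecMulVec_apply,
      productVector, Pi.star_apply, hea k, hfb k, Pi.smul_apply, smul_eq_mul, star_mul',
      Complex.star_def, Complex.conj_ofReal, Complex.ofReal_pow, Complex.ofReal_mul]
    ring
  refine ⟨N, fun k => (a k * b k * c k) ^ 2, e', f', g', fun k => sq_nonneg _, ?_,
    fun k => ⟨he1 k, hf1 k, hg1 k⟩, hsum⟩
  have hone : ∀ k, (vecMulVec (productVector (e' k) (f' k) (g' k))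
      (star (productVector (e' k) (f' k) (g' k)))).trace = 1 := by
    intro k
    have : star (productVector (e' k) (f' k) (g' k)) ⬝ᵥ productVector (e' k) (f' k) (g' k) =
        (star (e' k) ⬝ᵥ e' k) * ((star (f' k) ⬝ᵥ f' k) * (star (g' k) ⬝ᵥ g' k)) := by
      simp only [dotProduct, Fintype.sum_prod_type]
      rw [Finset.sum_mul]
      refine Finset.sum_congr rfl fun i _ => ?_
      rw [Finset.sum_mul, Finset.mul_sum]
      refine Finset.sum_congr rfl fun j _ => ?_
      rw [Finset.mul_sum, Finset.mul_sum]
      refine Finset.sum_congr rfl fun n _ => ?_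
      simp only [productVector, Pi.star_apply, star_mul']
      ring
    rw [trace_vecMulVec, dotProduct_comm, this, he1, hf1, hg1, one_mul, one_mul]
  rw [hsum, trace_sum] at htr
  simp only [trace_smul, hone, smul_eq_mul, mul_one] at htr
  exact_mod_cast htr

/-- Finitely many nonzero vectors of `ℂ²` all have a nonzero second component in a suitable
orthonormal basis. -/
theorem exists_unitary_mulVec_one_ne_zero {κ : Type*} [Finite κ] (e : κ → Fin 2 → ℂ)
    (he : ∀ k, e k ≠ 0) : ∃ U ∈ unitaryGroup (Fin 2) ℂ, ∀ k, (U *ᵥ e k) 1 ≠ 0 := by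
  -- The new second component will be proportional to `e k 0 + t * e k 1`; each `k` excludes at most
  -- one real `t`.
  have hbad : (⋃ k, {t : ℝ | e k 0 + t * e k 1 = 0}).Finite := by
    refine Set.finite_iUnion fun k => Set.Subsingleton.finite fun t ht t' ht' => ?_
    have h1 : e k 0 + t * e k 1 = 0 := ht
    have h2 : e k 0 + t' * e k 1 = 0 := ht'
    by_cases h : e k 1 = 0
    · refine absurd ?_ (he k)
      ext i
      fin_cases i
      · simpa [h] using h1
      · exact h
    · have : (t : ℂ) = t' := mul_right_cancel₀ h (by linear_combination h1 - h2)
      exact_mod_cast this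
  obtain ⟨t, ht⟩ := hbad.infinite_compl.nonempty
  have ht' : ∀ k, e k 0 + t * e k 1 ≠ 0 := fun k hk => ht (Set.mem_iUnion.mpr ⟨k, hk⟩)
  have hpos : 0 < 1 + t ^ 2 := by positivity
  have hsqrt : (Real.sqrt (1 + t ^ 2) : ℂ) ≠ 0 := by
    exact_mod_cast (Real.sqrt_pos.mpr hpos).ne'
  have hsq : (Real.sqrt (1 + t ^ 2) : ℂ) ^ 2 = 1 + t ^ 2 := by
    exact_mod_cast Real.sq_sqrt hpos.le
  refine ⟨(Real.sqrt (1 + t ^ 2) : ℂ)⁻¹ • !![-(t : ℂ), 1; 1, t], ?_, fun k => ?_⟩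
  · have hdd : (Real.sqrt (1 + t ^ 2) : ℂ)⁻¹ * (Real.sqrt (1 + t ^ 2) : ℂ)⁻¹ * (1 + t ^ 2) = 1 := by
      rw [← hsq]
      field_simp
    rw [mem_unitaryGroup_iff, star_eq_conjTranspose, conjTranspose_smul, smul_mul_smul_comm,
      star_inv₀, Complex.star_def, Complex.conj_ofReal]
    ext i j
    rw [Matrix.smul_apply, mul_apply, Fin.sum_univ_two, smul_eq_mul]
    fin_cases i <;> fin_cases j <;> simp [conjTranspose_apply] <;>
      linear_combination hdd
  · have : (((Real.sqrt (1 + t ^ 2) : ℂ)⁻¹ • !![-(t : ℂ), 1; 1, t]) *ᵥ e k) 1 =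
        (Real.sqrt (1 + t ^ 2) : ℂ)⁻¹ * (e k 0 + t * e k 1) := by
      simp [mulVec, dotProduct, Fin.sum_univ_two]
      ring
    rw [this]
    exact mul_ne_zero (inv_ne_zero hsqrt) (ht' k)

/-- Local operations of Alice and Bob act on the factors of product vectors. -/
theorem kronecker_mul_productMatrix {N : ℕ} (U V : Matrix (Fin 2) (Fin 2) ℂ)
    (e f : Fin N → Fin 2 → ℂ) (G : Matrix (Fin N) (Fin N) ℂ) :
    (U ⊗ₖ (V ⊗ₖ (1 : Matrix (Fin N) (Fin N) ℂ))) * productMatrix e f G =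
      productMatrix (fun k => U *ᵥ e k) (fun k => V *ᵥ f k) G := by
  ext x k
  simp only [mul_apply, productMatrix, of_apply, kroneckerMap_apply, Fintype.sum_prod_type,
    mulVec, dotProduct, one_apply]
  rw [Finset.sum_mul, Finset.sum_mul]
  refine Finset.sum_congr rfl fun i _ => ?_
  rw [Finset.mul_sum, Finset.sum_mul]
  refine Finset.sum_congr rfl fun j _ => ?_
  simp
  ring

/-- A sum of projectors onto product vectors, linearly independent on Charlie's side, whose
factors for Alice and Bob have nonzero second components, is in canonical form. -/
theorem exists_canonicalForm {N : ℕ} {G : Matrix (Fin N) (Fin N) ℂ} {e f : Fin N → Fin 2 → ℂ}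
    (hG : IsUnit G) (he : ∀ k, e k 1 ≠ 0) (hf : ∀ k, f k 1 ≠ 0) :
    ∃ B C D : Matrix (Fin N) (Fin N) ℂ,
      Commute B Bᴴ ∧ Commute C Cᴴ ∧ Commute C B ∧ Commute C Bᴴ ∧ D.PosDef ∧
        productMatrix e f G * (productMatrix e f G)ᴴ = canonicalForm B C D := by
  -- Absorbing the second components normalizes the `|11⟩` block to `1`.
  let G' := G * diagonal fun k => e k 1 * f k 1
  have hG' : IsUnit G' := by
    refine hG.mul ((isUnit_iff_isUnit_det _).mpr ?_)
    rw [det_diagonal, isUnit_iff_ne_zero]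
    exact Finset.prod_ne_zero_iff.mpr fun k _ => mul_ne_zero (he k) (hf k)
  let D := G' * G'ᴴ
  have hD : D.PosDef := (posSemidef_self_mul_conjTranspose G').posDef_iff_isUnit.mpr
    (hG'.mul ((isUnit_conjTranspose G').mpr hG'))
  let S := CFC.sqrt D
  have hSS : S * S = D := CFC.sqrt_mul_sqrt_self D hD.posSemidef.nonneg
  have hSh : Sᴴ = S := (nonneg_iff_posSemidef.mp (CFC.sqrt_nonneg D)).1
  have hSu : IsUnit S.det := by
    have := (isUnit_iff_isUnit_det D).mp hD.isUnit
    rw [← hSS, det_mul] at this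
    exact isUnit_of_mul_isUnit_left this
  -- The unitary factor of the polar decomposition `G' = √D W`.
  let W := S⁻¹ * G'
  have hWW : W * Wᴴ = 1 := by
    rw [conjTranspose_mul, conjTranspose_nonsing_inv, hSh, Matrix.mul_assoc S⁻¹,
      ← Matrix.mul_assoc G', show G' * G'ᴴ = S * S from hSS.symm, Matrix.mul_assoc S,
      mul_nonsing_inv _ hSu, Matrix.mul_one, nonsing_inv_mul _ hSu]
  have hWW' : Wᴴ * W = 1 := mul_eq_one_comm.mp hWW
  have hWS : Wᴴ * S = G'ᴴ := by
    rw [conjTranspose_mul, conjTranspose_nonsing_inv, hSh, Matrix.mul_assoc,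
      nonsing_inv_mul _ hSu, Matrix.mul_one]
  let Δ : (Fin N → ℂ) → Matrix (Fin N) (Fin N) ℂ := fun d => W * diagonal d * Wᴴ
  have hΔmul : ∀ d d', Δ d * Δ d' = Δ (fun k => d k * d' k) := by
    intro d d'
    simp only [Δ]
    rw [← diagonal_mul_diagonal, Matrix.mul_assoc (W * diagonal d), ← Matrix.mul_assoc Wᴴ,
      ← Matrix.mul_assoc Wᴴ, hWW', Matrix.one_mul]
    simp only [Matrix.mul_assoc]
  have hΔstar : ∀ d, (Δ d)ᴴ = Δ (star d) := by
    intro d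
    simp only [Δ, conjTranspose_mul, conjTranspose_conjTranspose, diagonal_conjTranspose,
      Matrix.mul_assoc]
  have hΔone : Δ (fun _ => 1) = 1 := by
    simp only [Δ, diagonal_one, Matrix.mul_one, hWW]
  have hΔcomm : ∀ d d', Commute (Δ d) (Δ d') := by
    intro d d'
    rw [Commute, SemiconjBy, hΔmul, hΔmul]
    simp only [mul_comm]
  -- The ratios are conjugated because the canonical row corresponds to the adjoint of
  -- `productMatrix`.
  let γ : Fin N → ℂ := fun k => star (f k 0 / f k 1)
  let β : Fin N → ℂ := fun k => star (e k 0 / e k 1)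
  refine ⟨Δ γ, Δ β, D, ?_, ?_, hΔcomm _ _, ?_, hD, ?_⟩
  · rw [hΔstar]
    exact hΔcomm _ _
  · rw [hΔstar]
    exact hΔcomm _ _
  · rw [hΔstar]
    exact hΔcomm _ _
  have hrow : ∀ n x, canonicalRow (Δ γ) (Δ β) n x =
      Δ (fun k => star (e k x.1 / e k 1) * star (f k x.2.1 / f k 1)) n x.2.2 := by
    rintro n ⟨i, j, m⟩
    fin_cases i <;> fin_cases j <;> simp [canonicalRow, hΔmul, hΔone, he, hf, β, γ]
  -- The two factors differ only by the unitary `W`, which cancels in the product with the adjoint.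
  have hmain : canonicalRow (Δ γ) (Δ β) * onCharlie S = W * (productMatrix e f G)ᴴ := by
    ext n x
    have h1 : (canonicalRow (Δ γ) (Δ β) * onCharlie S) n x =
        (Δ (fun k => star (e k x.1 / e k 1) * star (f k x.2.1 / f k 1)) * S) n x.2.2 := by
      rw [mul_apply, mul_apply, Fintype.sum_prod_type]
      simp only [Fintype.sum_prod_type, hrow, onCharlie, kroneckerMap_apply, one_apply]
      obtain ⟨i, j, m⟩ := x
      simp
    rw [h1]
    simp only [Δ]
    rw [Matrix.mul_assoc _ Wᴴ, hWS, Matrix.mul_assoc, mul_apply, mul_apply]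
    refine Finset.sum_congr rfl fun k _ => ?_
    rw [diagonal_mul, conjTranspose_apply, conjTranspose_apply]
    simp only [G', mul_diagonal, productMatrix, of_apply]
    rw [← star_mul', ← star_mul']
    congr 2
    have := he k
    have := hf k
    field_simp
  have hSc : (onCharlie S)ᴴ = onCharlie S := by
    simp [onCharlie, conjTranspose_kronecker, hSh]
  calc productMatrix e f G * (productMatrix e f G)ᴴ
      = (W * (productMatrix e f G)ᴴ)ᴴ * (W * (productMatrix e f G)ᴴ) := by
        rw [conjTranspose_mul, conjTranspose_conjTranspose, Matrix.mul_assoc,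
          ← Matrix.mul_assoc Wᴴ, hWW', Matrix.one_mul]
    _ = canonicalForm (Δ γ) (Δ β) D := by
        rw [← hmain, conjTranspose_mul, hSc, canonicalForm]
        simp only [Matrix.mul_assoc]
        rfl

end Tripartite

theorem theorem2 (N : ℕ) (ρ : Tripartite.Op N)
    (hstate : Tripartite.IsState ρ) (hppt : Tripartite.IsPPT ρ)
    (hsupp : Tripartite.IsSupported ρ) (hrank : ρ.rank = N) :
    Tripartite.IsSeparable ρ ∧
    ∃ U ∈ Matrix.unitaryGroup (Fin 2) ℂ, ∃ V ∈ Matrix.unitaryGroup (Fin 2) ℂ,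
      ∃ B C D : Matrix (Fin N) (Fin N) ℂ,
        Commute B Bᴴ ∧ Commute C Cᴴ ∧ Commute C B ∧ Commute C Bᴴ ∧ D.PosDef ∧
        (U ⊗ₖ (V ⊗ₖ (1 : Matrix (Fin N) (Fin N) ℂ))) * ρ *
            (U ⊗ₖ (V ⊗ₖ (1 : Matrix (Fin N) (Fin N) ℂ)))ᴴ =
          Tripartite.canonicalForm B C D := by
  obtain ⟨G, e, f, hG, he, hf, hρ⟩ :=
    Tripartite.exists_eq_productMatrix_mul hstate.1 hppt hsupp.2.2 hrank
  refine ⟨Tripartite.isSeparable_of_eq_productMatrix_mul hstate.2 hG he hf hρ, ?_⟩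
  obtain ⟨U, hU, hUe⟩ := Tripartite.exists_unitary_mulVec_one_ne_zero e he
  obtain ⟨V, hV, hVf⟩ := Tripartite.exists_unitary_mulVec_one_ne_zero f hf
  obtain ⟨B, C, D, hB, hC, hCB, hCB', hD, h⟩ := Tripartite.exists_canonicalForm hG hUe hVf
  refine ⟨U, hU, V, hV, B, C, D, hB, hC, hCB, hCB', hD, ?_⟩
  rw [← h, ← Tripartite.kronecker_mul_productMatrix, hρ, Matrix.conjTranspose_mul]
  simp only [Matrix.mul_assoc]
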